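/- \textbf{Setting.} A secondary transmitter (ST) serves $K$ secondary users ($K$ a positive even integer) over a total bandwidth $B>0$; consider one user pair, consisting of a near user $\mathrm n$ and a far user $\mathrm f$ with $N_{\mathrm n},N_{\mathrm f}\ge 1$ receive antennas, which is given the bandwidth $\mathcal B=2B/K$. The channel coefficients are $h_{\mathrm p}=\sqrt{\Omega_{\mathrm p}}\,\hat h_{\mathrm p}$ (ST to primary receiver) and $h_{u,i}=\sqrt{\Omega_u}\,\hat h_{u,i}$ (ST to antenna $i\in\{1,\dots,N_u\}$ of user $u\in\{\mathrm n,\mathrm f\}$), where $\Omega_{\mathrm p},\Omega_{\mathrm n},\Omega_{\mathrm f}>0$ and $\hat h_{\mathrm p}$ and all $\hat h_{u,i}$ are independent $\mathcal{CN}(0,1)$ random variables. Put $g_{\mathrm p}=|h_{\mathrm p}|^2$ and, after maximal-ratio combining, $g_u=\sum_{i=1}^{N_u}|h_{u,i}|^2$. The strong user is the (random) user $\mathrm s=\arg\max_{u\in\{\mathrm n,\mathrm f\}}g_u$, so $g_{\mathrm s}=\max\{g_{\mathrm n},g_{\mathrm f}\}$. The ST knows all these coefficients and transmits with power $I/g_{\mathrm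 p}$, where $I>0$ is the peak tolerable interference power; the power allocation coefficients satisfy $0<a_{\mathrm s}<a_{\mathrm w}$ and $a_{\mathrm s}+a_{\mathrm w}=2/K$. With noise power spectral density $\mathscr N_0>0$, fading block length $T>0$ and delay exponent $\theta>0$, put $\hat I=I/(\mathscr N_0\mathcal B)$, $\nu=\theta T\mathcal B/\ln 2$, $X_{\mathrm s}=g_{\mathrm s}/g_{\mathrm p}$; the SNR of the strong user is $\gamma_{\mathrm s}=a_{\mathrm s}\hat I X_{\mathrm s}$ and its effective rate is $$R_{\mathrm s}=-\frac1\nu\log_2\mathbb E\big[(1+a_{\mathrm s}\hat I X_{\mathrm s})^{-\nu}\big].$$ For integers $k\ge1$ and real $z>0$ write $$G_k(z)=G_{2,2}^{2,2}\Big(z\,\Big|\begin{smallmatrix}-k,&1-k\\0,&\nu-k\end{smallmatrix}\Big)=\frac1{2\pi i}\int_{\sigma-i\infty}^{\sigma+i\infty}\Gamma(-s)\,\Gamma(\nu-k-s)\,\Gamma(1+k+s)\,\Gamma(k+s)\,z^{s}\,ds$$ for this Meijer $G$-function, where $\sigma$ is any real number with $-k<\sigma<\min\{0,\nu-k\}$.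 \textbf{Theorem.} The integrals that define the functions $G_k(z)$ converge absolutely and do not depend on $\sigma$, the expectation above exists, and $$R_{\mathrm s}=-\frac1\nu\log_2\Big[T_1(N_{\mathrm n},\Omega_{\mathrm n})+T_1(N_{\mathrm f},\Omega_{\mathrm f})-T_2(N_{\mathrm n},N_{\mathrm f},\Omega_{\mathrm n},\Omega_{\mathrm f})-T_2(N_{\mathrm f},N_{\mathrm n},\Omega_{\mathrm f},\Omega_{\mathrm n})\Big],$$ where the number in brackets is real and positive and $$T_1(\alpha,\beta)=\frac{1}{\Gamma(\alpha)\Gamma(\nu)}\Big(\frac{\Omega_{\mathrm p}}{\beta a_{\mathrm s}\hat I}\Big)^{\alpha}G_\alpha\Big(\frac{\Omega_{\mathrm p}}{\beta a_{\mathrm s}\hat I}\Big),$$ $$T_2(\alpha_1,\alpha_2,\beta_1,\beta_2)=\sum_{\tau=0}^{\alpha_2-1}\frac{[\Omega_{\mathrm p}/(a_{\mathrm s}\hat I)]^{\alpha_1+\tau}}{\Gamma(\alpha_1)\Gamma(\nu)\,\beta_1^{\alpha_1}\beta_2^{\tau}\,\tau!}\;G_{\alpha_1+\tau}\Big(\frac{\Omega_{\mathrm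 p}}{\Omega a_{\mathrm s}\hat I}\Big),\qquad \Omega=\frac{\Omega_{\mathrm n}\Omega_{\mathrm f}}{\Omega_{\mathrm n}+\Omega_{\mathrm f}}.$$ -/

import Mathlib

open MeasureTheory ProbabilityTheory

noncomputable section

namespace NOMA

/-! ### Meijer's G-function -/

/-- The integrand of the Mellin–Barnes integral that defines
`G_{p,q}^{m,n}(z | a₁,…,a_p ; b₁,…,b_q)`, namely
`∏_{j ≤ m} Γ(b_j - s) ∏_{j ≤ n} Γ(1 - a_j + s) /
  (∏_{j > m} Γ(1 - b_j + s) ∏_{j > n} Γ(a_j - s)) * z ^ s`.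
(`Complex.Gamma` vanishes at its poles, so that the inverses below are the entire function `1/Γ`.) -/
def meijerIntegrand (m n : ℕ) {p q : ℕ} (a : Fin p → ℂ) (b : Fin q → ℂ) (z s : ℂ) : ℂ :=
  (∏ j : Fin q, if (j : ℕ) < m then Complex.Gamma (b j - s) else (Complex.Gamma (1 - b j + s))⁻¹) *
  (∏ j : Fin p, if (j : ℕ) < n then Complex.Gamma (1 - a j + s) else (Complex.Gamma (a j - s))⁻¹) *
  z ^ s

/-- The vertical line `Re s = σ` separates the poles `b_j + k` of `Γ(b_j - s)`, `j ≤ m`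
(on its right), from the poles `a_j - 1 - k` of `Γ(1 - a_j + s)`, `j ≤ n` (on its left). -/
def Separates (m n : ℕ) {p q : ℕ} (a : Fin p → ℂ) (b : Fin q → ℂ) (σ : ℝ) : Prop :=
  (∀ j : Fin q, (j : ℕ) < m → σ < (b j).re) ∧ (∀ j : Fin p, (j : ℕ) < n → (a j).re - 1 < σ)

/-- `(2πi)⁻¹ ∫_{σ - i∞}^{σ + i∞}` of the Mellin–Barnes integrand. -/
def mellinBarnes (m n : ℕ) {p q : ℕ} (a : Fin p → ℂ) (b : Fin q → ℂ) (z : ℂ) (σ : ℝ) : ℂ :=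
  (2 * Real.pi : ℂ)⁻¹ * ∫ t : ℝ, meijerIntegrand m n a b z (σ + t * Complex.I)

open Classical in
/-- Meijer's G-function `G_{p,q}^{m,n}(z | a ; b)`: the Mellin–Barnes integral over a vertical line
that separates the two families of poles (for parameters that admit such a line). -/
def meijerG (m n : ℕ) {p q : ℕ} (a : Fin p → ℂ) (b : Fin q → ℂ) (z : ℂ) : ℂ :=
  if h : ∃ σ : ℝ, Separates m n a b σ then mellinBarnes m n a b z h.choose else 0

/-- `G_{p,q}^{m,n}(z | a ; b)` is properly defined: a separating vertical line exists, and over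
each such line the integral converges absolutely and has the value `meijerG m n a b z`. -/
def MeijerGDefined (m n : ℕ) {p q : ℕ} (a : Fin p → ℂ) (b : Fin q → ℂ) (z : ℂ) : Prop :=
  (∃ σ : ℝ, Separates m n a b σ) ∧
    ∀ σ : ℝ, Separates m n a b σ →
      Integrable (fun t : ℝ => meijerIntegrand m n a b z (σ + t * Complex.I)) ∧
      mellinBarnes m n a b z σ = meijerG m n a b z

/-! ### The system model -/

/-- The circularly symmetric complex normal distribution `CN(0, 1)`, with density
`π⁻¹ exp(-|z|²)`. -/
def stdComplexNormal : Measure ℂ :=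
  volume.withDensity fun z => ENNReal.ofReal (Real.pi⁻¹ * Real.exp (-‖z‖ ^ 2))

/-- The two secondary users of a pair. -/
inductive User
  | near
  | far

/-- The deterministic parameters of the underlay downlink NOMA system, seen from one user pair. -/
structure Params where
  /-- number of secondary users -/
  K : ℕ
  /-- total bandwidth -/
  B : ℝ
  /-- length of a fading block -/
  T : ℝ
  /-- delay QoS exponent -/
  θ : ℝ
  /-- noise power spectral density -/
  N0 : ℝ
  /-- peak tolerable interference power at the primary receiver -/
  I : ℝ
  /-- power allocation coefficient of the strong user -/
  as : ℝ
  /-- power allocation coefficient of the weak user -/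
  aw : ℝ
  /-- path loss of the link to the primary receiver -/
  Ωp : ℝ
  /-- path losses of the links to the two users -/
  Ω : User → ℝ
  /-- numbers of receive antennas of the two users -/
  N : User → ℕ
  K_pos : 0 < K
  K_even : Even K
  B_pos : 0 < B
  T_pos : 0 < T
  θ_pos : 0 < θ
  N0_pos : 0 < N0
  I_pos : 0 < I
  as_pos : 0 < as
  as_lt_aw : as < aw
  as_add_aw : as + aw = 2 / (K : ℝ)
  Ωp_pos : 0 < Ωp
  Ω_pos : ∀ u, 0 < Ω u
  N_pos : ∀ u, 1 ≤ N u

namespace Params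

variable (P : Params)

/-- Bandwidth `2B/K` of the user pair. -/
def pairBandwidth : ℝ := 2 * P.B / (P.K : ℝ)

/-- `ν = θ T 𝓑 / ln 2`, with `𝓑` the bandwidth of the pair. -/
def ν : ℝ := P.θ * P.T * P.pairBandwidth / Real.log 2

/-- `Î = I / (N₀ 𝓑)`. -/
def Ihat : ℝ := P.I / (P.N0 * P.pairBandwidth)

/-- `Ω_n Ω_f / (Ω_n + Ω_f)`. -/
def Ωpair : ℝ := P.Ω .near * P.Ω .far / (P.Ω .near + P.Ω .far)

/-- Transmit power `I / g_p` of the secondary transmitter. -/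
def transmitPower (gp : ℝ) : ℝ := P.I / gp

variable {S : Type*}

/-- Gain `g_p = |h_p|²` of the interference link, where `h_p = √Ω_p ĥ_p`. -/
def gainPrimary (hp : S → ℂ) (s : S) : ℝ := ‖(Real.sqrt P.Ωp : ℂ) * hp s‖ ^ 2

/-- Gain `g_u = ∑ᵢ |h_{u,i}|²` of user `u` after maximal-ratio combining, `h_{u,i} = √Ω_u ĥ_{u,i}`. -/
def gain (h : (u : User) → Fin (P.N u) → S → ℂ) (u : User) (s : S) : ℝ :=
  ∑ i : Fin (P.N u), ‖(Real.sqrt (P.Ω u) : ℂ) * h u i s‖ ^ 2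

open Classical in
/-- The strong user: the one with the larger gain. -/
def strongUser (h : (u : User) → Fin (P.N u) → S → ℂ) (s : S) : User :=
  if P.gain h .far s ≤ P.gain h .near s then .near else .far

/-- SNR of the strong user for its own signal:
`γ_s = a_s P_t(g_p) g_s / (N₀ 𝓑)`. -/
def snrStrong (hp : S → ℂ) (h : (u : User) → Fin (P.N u) → S → ℂ) (s : S) : ℝ :=
  P.as * P.transmitPower (P.gainPrimary hp s) * P.gain h (P.strongUser h s) s /
    (P.N0 * P.pairBandwidth)

/-- Effective rate `-(1/ν) log₂ E[(1 + γ)^{-ν}]` of a user with SNR `γ`. -/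
def effectiveRate [MeasurableSpace S] (μ : Measure S) (γ : S → ℝ) : ℝ :=
  -(1 / P.ν) * Real.logb 2 (∫ s, (1 + γ s) ^ (-P.ν) ∂μ)

/-! ### The closed form -/

/-- `G_{2,2}^{2,2}(z | -k, 1-k ; 0, ν-k)`: upper parameters. -/
def upperPar (k : ℕ) : Fin 2 → ℂ := ![-(k : ℂ), 1 - (k : ℂ)]

/-- `G_{2,2}^{2,2}(z | -k, 1-k ; 0, ν-k)`: lower parameters. -/
def lowerPar (k : ℕ) : Fin 2 → ℂ := ![0, (P.ν : ℂ) - (k : ℂ)]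

/-- `T₁(α, β)`. -/
def T₁ (α : ℕ) (β : ℝ) : ℂ :=
  (((P.Ωp / (β * P.as * P.Ihat)) ^ α / (Real.Gamma α * Real.Gamma P.ν) : ℝ) : ℂ) *
    meijerG 2 2 (upperPar α) (P.lowerPar α) ((P.Ωp / (β * P.as * P.Ihat) : ℝ) : ℂ)

/-- `T₂(α₁, α₂, β₁, β₂)`. -/
def T₂ (α₁ α₂ : ℕ) (β₁ β₂ : ℝ) : ℂ :=
  ∑ τ ∈ Finset.range α₂,
    (((P.Ωp / (P.as * P.Ihat)) ^ (α₁ + τ) /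
        (Real.Gamma α₁ * Real.Gamma P.ν * β₁ ^ α₁ * β₂ ^ τ * (τ.factorial : ℝ)) : ℝ) : ℂ) *
      meijerG 2 2 (upperPar (α₁ + τ)) (P.lowerPar (α₁ + τ))
        ((P.Ωp / (P.Ωpair * P.as * P.Ihat) : ℝ) : ℂ)

end Params

end NOMA

end

/-!
The gain of the strong user is the maximum of two independent Erlang variables. Expanding the
Erlang distribution function of one user against the Erlang law of the other yields factors
`x ^ τ * exp (-s x)`, which turn a gamma law into a multiple of another gamma law. So the
expectation is a combination of means of `(1 + X / Y) ^ (-ν)` with `X` and `Y` independent gamma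
variables. Such a mean equals that of `exp (-Z X / Y)` with `Z ∼ Γ(ν, 1)` independent of `X` and
`Y`; writing `exp (-x)` as the Cahen–Mellin integral of `Γ(s) x ^ (-s)` and exchanging the
integrations leaves a product of moments of `X`, `Y` and `Z`, that is, the Mellin–Barnes integrand
of `G_{2,2}^{2,2}`.
-/

section GammaMeasure

variable {a r : ℝ}

theorem gammaMeasure_eq_withDensity_restrict (a r : ℝ) :
    gammaMeasure a r = (volume.restrict (Set.Ioi 0)).withDensity fun x ↦
      ENNReal.ofReal (r ^ a / Real.Gamma a * x ^ (a - 1) * Real.exp (-(r * x))) := by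
  rw [gammaMeasure, ← withDensity_indicator measurableSet_Ioi]
  refine withDensity_congr_ae ?_
  filter_upwards [Measure.ae_ne volume (0 : ℝ)] with x hx
  rcases hx.lt_or_gt with h | h
  · rw [gammaPDF_of_neg h, Set.indicator_of_notMem (Set.notMem_Ioi.2 h.le)]
  · rw [gammaPDF_of_nonneg h.le, Set.indicator_of_mem (Set.mem_Ioi.2 h)]

theorem ae_pos_gammaMeasure (a r : ℝ) : ∀ᵐ x ∂gammaMeasure a r, 0 < x := by
  rw [gammaMeasure_eq_withDensity_restrict]
  exact (withDensity_absolutelyContinuous _ _).ae_le (ae_restrict_mem measurableSet_Ioi)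

theorem nullSingletonClass_gammaMeasure (a r : ℝ) : NullSingletonClass (gammaMeasure a r) :=
  ⟨fun _ ↦ withDensity_absolutelyContinuous _ _ (measure_singleton _)⟩

theorem integral_gammaMeasure {E : Type*} [NormedAddCommGroup E] [NormedSpace ℝ E]
    (ha : 0 < a) (hr : 0 < r) (f : ℝ → E) :
    ∫ x, f x ∂gammaMeasure a r =
      ∫ x in Set.Ioi 0, (r ^ a / Real.Gamma a * x ^ (a - 1) * Real.exp (-(r * x))) • f x := by
  rw [gammaMeasure_eq_withDensity_restrict, integral_withDensity_eq_integral_toReal_smul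
    (by fun_prop) (ae_of_all _ fun _ ↦ ENNReal.ofReal_lt_top)]
  refine setIntegral_congr_fun measurableSet_Ioi fun x hx ↦ ?_
  have hx : 0 < x := hx
  simp only [ENNReal.toReal_ofReal
    (show 0 ≤ r ^ a / Real.Gamma a * x ^ (a - 1) * Real.exp (-(r * x)) by positivity)]

theorem integral_rpow_mul_exp_smul_gammaMeasure {E : Type*} [NormedAddCommGroup E]
    [NormedSpace ℝ E] (ha : 0 < a) (hr : 0 < r) {p s : ℝ} (hap : 0 < a + p) (hrs : 0 < r + s)
    (f : ℝ → E) :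
    ∫ x, (x ^ p * Real.exp (-(s * x))) • f x ∂gammaMeasure a r =
      (r ^ a * Real.Gamma (a + p) / (Real.Gamma a * (r + s) ^ (a + p))) •
        ∫ x, f x ∂gammaMeasure (a + p) (r + s) := by
  rw [integral_gammaMeasure ha hr, integral_gammaMeasure hap hrs, ← integral_smul]
  refine setIntegral_congr_fun measurableSet_Ioi fun x (hx : 0 < x) ↦ ?_
  have hpow : x ^ (a + p - 1) = x ^ (a - 1) * x ^ p := by
    rw [← Real.rpow_add hx]
    ring_nf
  have hexp : Real.exp (-((r + s) * x)) = Real.exp (-(r * x)) * Real.exp (-(s * x)) := by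
    rw [← Real.exp_add]
    ring_nf
  simp only [smul_smul]
  rw [hpow, hexp]
  congr 1
  field_simp

theorem integral_rpow_mul_exp_gammaMeasure (ha : 0 < a) (hr : 0 < r) {p s : ℝ}
    (hap : 0 < a + p) (hrs : 0 < r + s) :
    ∫ x, x ^ p * Real.exp (-(s * x)) ∂gammaMeasure a r =
      r ^ a * Real.Gamma (a + p) / (Real.Gamma a * (r + s) ^ (a + p)) := by
  have := isProbabilityMeasure_gammaMeasure hap hrs
  simpa using integral_rpow_mul_exp_smul_gammaMeasure ha hr hap hrs fun _ ↦ (1 : ℝ)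

theorem integrable_rpow_gammaMeasure (ha : 0 < a) (hr : 0 < r) {p : ℝ} (hap : 0 < a + p) :
    Integrable (fun x ↦ x ^ p) (gammaMeasure a r) := by
  have h := integral_rpow_mul_exp_gammaMeasure ha hr hap (s := 0) (by simpa)
  simp only [zero_mul, neg_zero, Real.exp_zero, mul_one] at h
  refine .of_integral_ne_zero ?_
  rw [h]
  positivity

theorem mgf_id_gammaMeasure (ha : 0 < a) (hr : 0 < r) {t : ℝ} (ht : t < r) :
    mgf id (gammaMeasure a r) t = (r / (r - t)) ^ a := by
  have h := integral_rpow_mul_exp_gammaMeasure ha hr (p := 0) (s := -t) (by simpa) (by linarith)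
  simp only [Real.rpow_zero, one_mul, neg_mul, neg_neg, add_zero, ← sub_eq_add_neg] at h
  rw [mgf, Real.div_rpow hr.le (sub_pos.2 ht).le]
  simp only [id_eq, h]
  field_simp

theorem integral_cpow_gammaMeasure (ha : 0 < a) (hr : 0 < r) {w : ℂ} (hw : 0 < a + w.re) :
    ∫ x, (x : ℂ) ^ w ∂gammaMeasure a r =
      (r : ℂ) ^ (-w) * Complex.Gamma (a + w) / Complex.Gamma a := by
  have hr' : (r : ℂ) ≠ 0 := by exact_mod_cast hr.ne'
  calc ∫ x, (x : ℂ) ^ w ∂gammaMeasure a r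
      = ∫ x in Set.Ioi (0 : ℝ), ((r : ℂ) ^ (a : ℂ) / Complex.Gamma a) *
          ((x : ℂ) ^ (a + w - 1) * Complex.exp (-(r * x))) := by
        rw [integral_gammaMeasure ha hr]
        refine setIntegral_congr_fun measurableSet_Ioi fun x (hx : 0 < x) ↦ ?_
        have hx' : (x : ℂ) ≠ 0 := by exact_mod_cast hx.ne'
        simp only [Complex.real_smul, Complex.ofReal_mul, Complex.ofReal_div,
          Complex.ofReal_cpow hr.le, Complex.ofReal_cpow hx.le, Complex.Gamma_ofReal,
          Complex.ofReal_exp, Complex.ofReal_neg, Complex.ofReal_sub, Complex.ofReal_one]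
        rw [show (a : ℂ) + w - 1 = (a - 1) + w by ring, Complex.cpow_add _ _ hx']
        ring
    _ = (r : ℂ) ^ (-w) * Complex.Gamma (a + w) / Complex.Gamma a := by
        rw [integral_const_mul, Complex.integral_cpow_mul_exp_neg_mul_Ioi (by simpa) hr, one_div,
          Complex.inv_cpow_eq_ite, if_neg (by simp [Complex.arg_ofReal_of_nonneg hr.le,
            Real.pi_ne_zero.symm]), ← Complex.cpow_neg,
          show -((a : ℂ) + w) = -a + -w by ring, Complex.cpow_add _ _ hr',
          Complex.cpow_neg _ (a : ℂ)]
        have : (r : ℂ) ^ (a : ℂ) ≠ 0 := by simp [Complex.cpow_eq_zero_iff, hr']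
        field_simp

-- Both complex moment generating functions are analytic on `re z < r` and agree at the real points,
-- hence also on the imaginary axis, where they are the characteristic functions.
theorem hasLaw_gammaMeasure_of_mgf {S : Type*} [MeasurableSpace S] {μ : Measure S}
    [IsFiniteMeasure μ] {X : S → ℝ} (hX : AEMeasurable X μ) (ha : 0 < a) (hr : 0 < r)
    (h : ∀ t < r, mgf X μ t = (r / (r - t)) ^ a) : HasLaw X (gammaMeasure a r) μ where
  aemeasurable := hX
  map_eq := by
    have := isProbabilityMeasure_gammaMeasure ha hr
    have hne : ∀ t < r, (r / (r - t)) ^ a ≠ 0 := fun t ht ↦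
      (Real.rpow_pos_of_pos (div_pos hr (sub_pos.2 ht)) a).ne'
    have hintX : Set.Iio r ⊆ interior (integrableExpSet X μ) :=
      isOpen_Iio.subset_interior_iff.2 fun t ht ↦ .of_integral_ne_zero <| by
        simpa [mgf] using (h t ht).trans_ne (hne t ht)
    have hintΓ : Set.Iio r ⊆ interior (integrableExpSet id (gammaMeasure a r)) :=
      isOpen_Iio.subset_interior_iff.2 fun t ht ↦ .of_integral_ne_zero <| by
        simpa [mgf] using (mgf_id_gammaMeasure ha hr ht).trans_ne (hne t ht)
    have hstrip : Set.EqOn (complexMGF X μ) (complexMGF id (gammaMeasure a r)) {z | z.re < r} := by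
      refine AnalyticOnNhd.eqOn_of_preconnected_of_frequently_eq (z₀ := 0)
        (analyticOnNhd_complexMGF.mono fun z hz ↦ hintX hz)
        (analyticOnNhd_complexMGF.mono fun z hz ↦ hintΓ hz)
        (convex_halfSpace_re_lt r).isPreconnected hr ?_
      have hreal : ∃ᶠ t : ℝ in nhdsWithin 0 {0}ᶜ,
          complexMGF X μ t = complexMGF id (gammaMeasure a r) t :=
        Filter.Eventually.frequently <|
          (eventually_nhdsWithin_of_eventually_nhds (gt_mem_nhds hr)).mono fun t ht ↦ by
            rw [complexMGF_ofReal, complexMGF_ofReal, h t ht, mgf_id_gammaMeasure ha hr ht]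
      refine Filter.Tendsto.frequently ?_ hreal
      simpa using (Complex.continuous_ofReal.continuousWithinAt (s := {0}ᶜ)
        (x := 0)).tendsto_nhdsWithin (t := {0}ᶜ) (by simp +contextual [Set.MapsTo])
    refine Measure.ext_of_charFun (funext fun t ↦ ?_)
    rw [← complexMGF_mul_I hX, hstrip (by simpa using hr), complexMGF_id_mul_I]

theorem hasLaw_sum_gammaMeasure {S ι : Type*} [MeasurableSpace S] {μ : Measure S} {X : ι → S → ℝ}
    {a : ι → ℝ} {s : Finset ι} (hs : s.Nonempty) (ha : ∀ i ∈ s, 0 < a i) (hr : 0 < r)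
    (hX : ∀ i, HasLaw (X i) (gammaMeasure (a i) r) μ) (hind : iIndepFun X μ) :
    HasLaw (∑ i ∈ s, X i) (gammaMeasure (∑ i ∈ s, a i) r) μ := by
  have := hind.isProbabilityMeasure
  refine hasLaw_gammaMeasure_of_mgf
    (s.aemeasurable_sum fun i _ ↦ (hX i).aemeasurable) (s.sum_pos ha hs) hr
    fun t ht ↦ ?_
  rw [hind.mgf_sum₀ fun i ↦ (hX i).aemeasurable, Real.rpow_sum_of_pos (div_pos hr (sub_pos.2 ht))]
  refine Finset.prod_congr rfl fun i hi ↦ ?_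
  rw [← mgf_id_map (hX i).aemeasurable, (hX i).map_eq, mgf_id_gammaMeasure (ha i hi) hr ht]

end GammaMeasure

section CahenMellin

theorem norm_Gamma_le_Gamma_re {s : ℂ} (hs : 0 < s.re) :
    ‖Complex.Gamma s‖ ≤ Real.Gamma s.re := by
  rw [Complex.Gamma_eq_integral hs, Complex.GammaIntegral, Real.Gamma_eq_integral hs]
  refine (norm_integral_le_integral_norm _).trans_eq ?_
  refine setIntegral_congr_fun measurableSet_Ioi fun x (hx : 0 < x) ↦ ?_
  simp [Complex.norm_cpow_eq_rpow_re_of_pos hx, Complex.norm_exp]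

-- Two steps of `Γ(s + 1) = s Γ(s)` gain the factor `|s|²`.
theorem norm_Gamma_le_div_normSq {s : ℂ} (hs : 0 < s.re) :
    ‖Complex.Gamma s‖ ≤ Real.Gamma (s.re + 2) / (s.re ^ 2 + s.im ^ 2) := by
  have hs₀ : s ≠ 0 := fun h ↦ by simp [h] at hs
  have hs₁ : s + 1 ≠ 0 := fun h ↦ by
    have := congrArg Complex.re h
    simp only [Complex.add_re, Complex.one_re, Complex.zero_re] at this
    linarith
  have hrec : Complex.Gamma (s + 2) = (s + 1) * s * Complex.Gamma s := by
    rw [show s + 2 = s + 1 + 1 by ring, Complex.Gamma_add_one _ hs₁, Complex.Gamma_add_one _ hs₀,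
      mul_assoc]
  have hsq : s.re ^ 2 + s.im ^ 2 = ‖s‖ * ‖s‖ := by
    rw [Complex.norm_mul_self_eq_normSq, Complex.normSq_apply]
    ring
  have hle : ‖s‖ ≤ ‖s + 1‖ := by
    rw [Complex.norm_def, Complex.norm_def, Complex.normSq_apply, Complex.normSq_apply]
    refine Real.sqrt_le_sqrt ?_
    simp only [Complex.add_re, Complex.one_re, Complex.add_im, Complex.one_im]
    nlinarith
  rw [hsq, le_div_iff₀ (by positivity)]
  calc ‖Complex.Gamma s‖ * (‖s‖ * ‖s‖) ≤ ‖Complex.Gamma s‖ * (‖s + 1‖ * ‖s‖) := by gcongr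
    _ = ‖Complex.Gamma (s + 2)‖ := by rw [hrec, norm_mul, norm_mul]; ring
    _ ≤ Real.Gamma (s.re + 2) := by
      simpa using norm_Gamma_le_Gamma_re (s := s + 2) (by simpa using by linarith)

theorem continuous_Gamma_vertical {c : ℝ} (hc : 0 < c) :
    Continuous fun t : ℝ ↦ Complex.Gamma (c + t * Complex.I) := by
  refine continuous_iff_continuousAt.2 fun t ↦ ContinuousAt.comp
    (f := fun t : ℝ ↦ (c + t * Complex.I : ℂ)) (Complex.continuousAt_Gamma _ fun m h ↦ ?_)
    (by fun_prop)
  have hre := congrArg Complex.re h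
  simp only [Complex.add_re, Complex.ofReal_re, Complex.re_ofReal_mul, Complex.I_re, mul_zero,
    add_zero, Complex.neg_re, Complex.natCast_re] at hre
  linarith [m.cast_nonneg (α := ℝ)]

theorem verticalIntegrable_Gamma {c : ℝ} (hc : 0 < c) :
    Complex.VerticalIntegrable Complex.Gamma c := by
  have hbound : Integrable fun t : ℝ ↦
      Real.Gamma (c + 2) / c ^ 2 * (1 + (c⁻¹ * t) ^ 2)⁻¹ :=
    (integrable_inv_one_add_sq.comp_mul_left' (inv_ne_zero hc.ne')).const_mul _
  refine hbound.mono' (continuous_Gamma_vertical hc).aestronglyMeasurable (ae_of_all _ fun t ↦ ?_)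
  refine (norm_Gamma_le_div_normSq (by simpa using hc)).trans_eq ?_
  simp only [Complex.add_re, Complex.ofReal_re, Complex.re_ofReal_mul, Complex.I_re, mul_zero,
    add_zero, Complex.add_im, Complex.ofReal_im, Complex.im_ofReal_mul, Complex.I_im, mul_one,
    zero_add]
  field_simp

theorem mellin_exp_neg {s : ℂ} (hs : 0 < s.re) :
    mellin (fun x ↦ (Real.exp (-x) : ℂ)) s = Complex.Gamma s := by
  rw [Complex.Gamma_eq_integral hs, Complex.GammaIntegral_eq_mellin]

theorem exp_neg_eq_integral_Gamma {c x : ℝ} (hc : 0 < c) (hx : 0 < x) :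
    (Real.exp (-x) : ℂ) = (2 * Real.pi : ℂ)⁻¹ *
      ∫ t : ℝ, Complex.Gamma (c + t * Complex.I) * (x : ℂ) ^ (-(c + t * Complex.I)) := by
  have hmellin (t : ℝ) : mellin (fun x ↦ (Real.exp (-x) : ℂ)) (c + t * Complex.I) =
      Complex.Gamma (c + t * Complex.I) := mellin_exp_neg (by simpa)
  have hconv : MellinConvergent (fun x ↦ (Real.exp (-x) : ℂ)) c := by
    simpa only [MellinConvergent, smul_eq_mul, mul_comm] using
      Complex.GammaIntegral_convergent (s := c) (by simpa)
  have hint : Complex.VerticalIntegrable (mellin fun x ↦ (Real.exp (-x) : ℂ)) c := by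
    simpa only [Complex.VerticalIntegrable, hmellin] using verticalIntegrable_Gamma hc
  have hinv := mellinInv_mellin_eq c (fun x ↦ (Real.exp (-x) : ℂ)) hx hconv hint (by fun_prop)
  simp only [mellinInv, hmellin, smul_eq_mul, Complex.real_smul] at hinv
  rw [← hinv]
  simp [mul_comm]

variable {S : Type*} [MeasurableSpace S] {ρ : Measure S} {X : S → ℝ} {c : ℝ}

theorem integrable_Gamma_mul_cpow_prod (hc : 0 < c) (hX : AEMeasurable X ρ)
    (hpos : ∀ᵐ s ∂ρ, 0 < X s) (hint : Integrable (fun s ↦ X s ^ (-c)) ρ) :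
    Integrable (fun p : S × ℝ ↦
      Complex.Gamma (c + p.2 * Complex.I) * (X p.1 : ℂ) ^ (-(c + p.2 * Complex.I)))
      (ρ.prod volume) := by
  have hΓ : Integrable fun t : ℝ ↦ Complex.Gamma (c + t * Complex.I) := verticalIntegrable_Gamma hc
  refine (hint.ofReal (𝕜 := ℂ).mul_prod hΓ).mono ?_ ?_
  · exact ((continuous_Gamma_vertical hc).measurable.comp measurable_snd).aestronglyMeasurable.mul
      (AEMeasurable.aestronglyMeasurable (by fun_prop))
  · filter_upwards [Measure.quasiMeasurePreserving_fst.ae hpos] with p hp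
    simp [Complex.norm_cpow_eq_rpow_re_of_pos hp, abs_of_pos (Real.rpow_pos_of_pos hp _),
      mul_comm]

theorem integrable_Gamma_mul_integral_cpow [SFinite ρ] (hc : 0 < c) (hX : AEMeasurable X ρ)
    (hpos : ∀ᵐ s ∂ρ, 0 < X s) (hint : Integrable (fun s ↦ X s ^ (-c)) ρ) :
    Integrable fun t : ℝ ↦ Complex.Gamma (c + t * Complex.I) *
      ∫ s, (X s : ℂ) ^ (-(c + t * Complex.I)) ∂ρ := by
  simpa only [integral_const_mul] using
    (integrable_Gamma_mul_cpow_prod hc hX hpos hint).integral_prod_right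

theorem integral_exp_neg_eq_integral_Gamma_mul [SFinite ρ] (hc : 0 < c) (hX : AEMeasurable X ρ)
    (hpos : ∀ᵐ s ∂ρ, 0 < X s) (hint : Integrable (fun s ↦ X s ^ (-c)) ρ) :
    ((∫ s, Real.exp (-X s) ∂ρ : ℝ) : ℂ) = (2 * Real.pi : ℂ)⁻¹ *
      ∫ t : ℝ, Complex.Gamma (c + t * Complex.I) *
        ∫ s, (X s : ℂ) ^ (-(c + t * Complex.I)) ∂ρ := by
  simp only [← integral_const_mul]
  rw [← integral_complex_ofReal, ← integral_integral_swap
    ((integrable_Gamma_mul_cpow_prod hc hX hpos hint).const_mul _)]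
  refine integral_congr_ae (hpos.mono fun s hs ↦ ?_)
  simp only [exp_neg_eq_integral_Gamma hc hs, integral_const_mul]

end CahenMellin

section Erlang

theorem hasDerivAt_sum_pow_div_factorial (m : ℕ) (x : ℝ) :
    HasDerivAt (fun y : ℝ ↦ ∑ τ ∈ Finset.range (m + 1), y ^ τ / τ.factorial)
      (∑ τ ∈ Finset.range m, x ^ τ / τ.factorial) x := by
  refine (HasDerivAt.fun_sum fun τ _ ↦ (hasDerivAt_pow τ x).div_const _).congr_deriv ?_
  rw [Finset.sum_range_succ']
  simp only [Nat.cast_zero, zero_mul, zero_div, add_zero, Nat.add_sub_cancel]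
  refine Finset.sum_congr rfl fun τ _ ↦ ?_
  rw [Nat.factorial_succ, Nat.cast_mul, mul_div_mul_left _ _ (by positivity)]

theorem hasDerivAt_exp_neg_mul_sum (m : ℕ) (x : ℝ) :
    HasDerivAt (fun y ↦ -(Real.exp (-y) * ∑ τ ∈ Finset.range (m + 1), y ^ τ / τ.factorial))
      (Real.exp (-x) * (x ^ m / m.factorial)) x := by
  refine ((hasDerivAt_neg x).exp.fun_mul (hasDerivAt_sum_pow_div_factorial m x)).fun_neg.congr_deriv
    ?_
  rw [Finset.sum_range_succ]
  ring

theorem integral_exp_neg_mul_pow_div_factorial (m : ℕ) (x : ℝ) :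
    ∫ y in 0..x, Real.exp (-y) * (y ^ m / m.factorial) =
      1 - Real.exp (-x) * ∑ τ ∈ Finset.range (m + 1), x ^ τ / τ.factorial := by
  rw [intervalIntegral.integral_eq_sub_of_hasDerivAt (fun y _ ↦ hasDerivAt_exp_neg_mul_sum m y)
    (Continuous.intervalIntegrable (by fun_prop) _ _)]
  simp [Finset.sum_range_succ', neg_add_eq_sub]

theorem gammaMeasure_natCast_real_Iic {n : ℕ} (hn : n ≠ 0) {r x : ℝ} (hr : 0 < r) (hx : 0 ≤ x) :
    (gammaMeasure n r).real (Set.Iic x) =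
      1 - Real.exp (-(r * x)) * ∑ τ ∈ Finset.range n, (r * x) ^ τ / τ.factorial := by
  obtain ⟨m, rfl⟩ := Nat.exists_eq_succ_of_ne_zero hn
  have hdensity (y : ℝ) : r ^ ((m + 1 : ℕ) : ℝ) / Real.Gamma (m + 1 : ℕ) *
      y ^ (((m + 1 : ℕ) : ℝ) - 1) * Real.exp (-(r * y)) =
        r * (Real.exp (-(r * y)) * ((r * y) ^ m / m.factorial)) := by
    rw [Nat.cast_succ, Real.Gamma_nat_eq_factorial, add_sub_cancel_right, ← Nat.cast_succ,
      Real.rpow_natCast, Real.rpow_natCast, pow_succ]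
    ring
  calc (gammaMeasure (m + 1 : ℕ) r).real (Set.Iic x)
      = ∫ y in Set.Ioi 0, (Set.Iic x).indicator
          (fun y ↦ r * (Real.exp (-(r * y)) * ((r * y) ^ m / m.factorial))) y := by
        rw [← integral_indicator_one measurableSet_Iic,
          integral_gammaMeasure (Nat.cast_pos.2 m.succ_pos) hr]
        simp only [hdensity, smul_eq_mul, Set.indicator_apply, Pi.one_apply, mul_ite,
          mul_one, mul_zero]
    _ = ∫ y in 0..x, r * (Real.exp (-(r * y)) * ((r * y) ^ m / m.factorial)) := by
        rw [setIntegral_indicator measurableSet_Iic, Set.Ioi_inter_Iic,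
          intervalIntegral.integral_of_le hx]
    _ = ∫ y in 0..r * x, Real.exp (-y) * (y ^ m / m.factorial) := by
        rw [intervalIntegral.integral_const_mul,
          intervalIntegral.mul_integral_comp_mul_left
            (f := fun y ↦ Real.exp (-y) * (y ^ m / m.factorial)), mul_zero]
    _ = 1 - Real.exp (-(r * x)) * ∑ τ ∈ Finset.range (m + 1), (r * x) ^ τ / τ.factorial :=
        integral_exp_neg_mul_pow_div_factorial m _

variable {E : Type*} [NormedAddCommGroup E] [NormedSpace ℝ E]

theorem integrable_exp_neg_mul_pow_smul_gammaMeasure {a r s : ℝ} (hs : 0 ≤ s) {φ : ℝ → E}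
    (hφ : Integrable φ (gammaMeasure a r)) (τ : ℕ) :
    Integrable (fun x ↦ (Real.exp (-(s * x)) * ((s * x) ^ τ / τ.factorial)) • φ x)
      (gammaMeasure a r) := by
  refine Integrable.bdd_smul (φ := fun x ↦ Real.exp (-(s * x)) * ((s * x) ^ τ / τ.factorial)) hφ 1
    (Continuous.aestronglyMeasurable (by fun_prop)) ?_
  filter_upwards [ae_pos_gammaMeasure a r] with x hx
  have hsx : 0 ≤ s * x := mul_nonneg hs hx.le
  rw [Real.norm_of_nonneg (by positivity), Real.exp_neg, inv_mul_le_one₀ (Real.exp_pos _)]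
  exact Real.pow_div_factorial_le_exp _ hsx _

theorem integral_exp_neg_mul_pow_smul_gammaMeasure {a r s : ℝ} (ha : 0 < a) (hr : 0 < r)
    (hs : 0 ≤ s) (φ : ℝ → E) (τ : ℕ) :
    ∫ x, (Real.exp (-(s * x)) * ((s * x) ^ τ / τ.factorial)) • φ x ∂gammaMeasure a r =
      (s ^ τ / τ.factorial *
        (r ^ a * Real.Gamma (a + τ) / (Real.Gamma a * (r + s) ^ (a + τ)))) •
          ∫ x, φ x ∂gammaMeasure (a + τ) (r + s) := by
  rw [mul_smul, ← integral_rpow_mul_exp_smul_gammaMeasure ha hr (by positivity) (by positivity),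
    ← integral_smul]
  refine integral_congr_ae (ae_of_all _ fun x ↦ ?_)
  simp only [smul_smul, Real.rpow_natCast, mul_pow]
  ring_nf

theorem integral_real_Iic_smul_gammaMeasure {a r s : ℝ} {n : ℕ} (ha : 0 < a) (hr : 0 < r)
    (hn : n ≠ 0) (hs : 0 < s) {φ : ℝ → E} (hφ : Integrable φ (gammaMeasure a r)) :
    ∫ x, (gammaMeasure n s).real (Set.Iic x) • φ x ∂gammaMeasure a r =
      ∫ x, φ x ∂gammaMeasure a r - ∑ τ ∈ Finset.range n,
        (s ^ τ / τ.factorial *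
          (r ^ a * Real.Gamma (a + τ) / (Real.Gamma a * (r + s) ^ (a + τ)))) •
            ∫ x, φ x ∂gammaMeasure (a + τ) (r + s) := by
  have hint := integrable_exp_neg_mul_pow_smul_gammaMeasure hs.le hφ
  simp only [← integral_exp_neg_mul_pow_smul_gammaMeasure ha hr hs.le]
  rw [← integral_finsetSum _ fun τ _ ↦ hint τ,
    ← integral_sub hφ (integrable_finsetSum _ fun τ _ ↦ hint τ)]
  refine integral_congr_ae ?_
  filter_upwards [ae_pos_gammaMeasure a r] with x hx
  rw [gammaMeasure_natCast_real_Iic hn hs hx.le, sub_smul, one_smul, Finset.mul_sum,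
    Finset.sum_smul]

theorem integral_comp_max_prod [CompleteSpace E] {α : Type*} [LinearOrder α] [TopologicalSpace α]
    [OrderClosedTopology α] [SecondCountableTopology α] [MeasurableSpace α]
    [OpensMeasurableSpace α] {μ₁ μ₂ : Measure α} [IsFiniteMeasure μ₁] [IsFiniteMeasure μ₂]
    [NullSingletonClass μ₁] {φ : α → E} (h₁ : Integrable φ μ₁) (h₂ : Integrable φ μ₂) :
    ∫ p, φ (max p.1 p.2) ∂μ₁.prod μ₂ =
      ∫ x, μ₂.real (Set.Iic x) • φ x ∂μ₁ + ∫ y, μ₁.real (Set.Iic y) • φ y ∂μ₂ := by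
  have hsplit (p : α × α) : φ (max p.1 p.2) =
      {p : α × α | p.2 ≤ p.1}.indicator (fun p ↦ φ p.1) p +
        {p : α × α | p.1 < p.2}.indicator (fun p ↦ φ p.2) p := by
    rcases le_or_gt p.2 p.1 with h | h
    · simp [h]
    · simp [h, h.le]
  have hle := (h₁.comp_fst μ₂).indicator (measurableSet_le measurable_snd measurable_fst)
  have hlt := (h₂.comp_snd μ₁).indicator (measurableSet_lt measurable_fst measurable_snd)
  simp only [hsplit]
  rw [integral_add hle hlt, integral_prod _ hle, integral_prod_symm _ hlt]
  congr 1
  · refine integral_congr_ae (ae_of_all _ fun x ↦ ?_)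
    exact integral_indicator_const (φ x) measurableSet_Iic
  · refine integral_congr_ae (ae_of_all _ fun y ↦ ?_)
    beta_reduce
    rw [measureReal_congr (Iio_ae_eq_Iic (μ := μ₁) (a := y)).symm]
    exact integral_indicator_const (φ y) measurableSet_Iio

end Erlang

section Independence

theorem indepFun_pi_of_disjoint_range {S ι α β : Type*} {E : ι → Type*} [MeasurableSpace S]
    {μ : Measure S} [∀ i, MeasurableSpace (E i)] [Finite α] [Finite β] {f : ∀ i, S → E i}
    (hf : iIndepFun f μ) (hm : ∀ i, AEMeasurable (f i) μ) {e₁ : α → ι} {e₂ : β → ι}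
    (he : Disjoint (Set.range e₁) (Set.range e₂)) :
    IndepFun (fun s a ↦ f (e₁ a) s) (fun s b ↦ f (e₂ b) s) μ :=
  (hf.indepFun_finset₀ (Set.finite_range e₁).toFinset (Set.finite_range e₂).toFinset
    (Set.Finite.disjoint_toFinset.2 he) hm).comp
    (φ := fun (v : ∀ i : (Set.finite_range e₁).toFinset, E i) a ↦ v ⟨e₁ a, by simp⟩)
    (ψ := fun (v : ∀ i : (Set.finite_range e₂).toFinset, E i) b ↦ v ⟨e₂ b, by simp⟩)
    (measurable_pi_lambda _ fun _ ↦ measurable_pi_apply _)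
    (measurable_pi_lambda _ fun _ ↦ measurable_pi_apply _)

end Independence

namespace NOMA

section MeijerG

variable {m n p q : ℕ} {a : Fin p → ℂ} {b : Fin q → ℂ} {z : ℂ}

theorem meijerGDefined_and_eq_of_forall {G : ℂ} (hex : ∃ σ, Separates m n a b σ)
    (h : ∀ σ, Separates m n a b σ →
      Integrable (fun t : ℝ ↦ meijerIntegrand m n a b z (σ + t * Complex.I)) ∧
        mellinBarnes m n a b z σ = G) :
    MeijerGDefined m n a b z ∧ meijerG m n a b z = G := by
  have hG : meijerG m n a b z = G := by rw [meijerG, dif_pos hex, (h _ hex.choose_spec).2]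
  exact ⟨⟨hex, fun σ hσ ↦ ⟨(h σ hσ).1, (h σ hσ).2.trans hG.symm⟩⟩, hG⟩

theorem separates_add_const {w σ : ℝ} :
    Separates m n (fun j ↦ a j + w) (fun j ↦ b j + w) (σ + w) ↔ Separates m n a b σ := by
  simp only [Separates, Complex.add_re, Complex.ofReal_re, add_lt_add_iff_right,
    add_sub_right_comm]

theorem meijerIntegrand_add_const (hz : z ≠ 0) (w s : ℂ) :
    meijerIntegrand m n (fun j ↦ a j + w) (fun j ↦ b j + w) z (s + w) =
      z ^ w * meijerIntegrand m n a b z s := by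
  have hshift (c : ℂ) : 1 - (c + w) + (s + w) = 1 - c + s := by ring
  simp only [meijerIntegrand, add_sub_add_right_eq_sub, hshift, Complex.cpow_add _ _ hz]
  ring

theorem MeijerGDefined.add_const (hz : z ≠ 0) (h : MeijerGDefined m n a b z) (w : ℝ) :
    MeijerGDefined m n (fun j ↦ a j + w) (fun j ↦ b j + w) z ∧
      meijerG m n (fun j ↦ a j + w) (fun j ↦ b j + w) z = z ^ (w : ℂ) * meijerG m n a b z := by
  obtain ⟨⟨σ₀, hσ₀⟩, h⟩ := h
  refine meijerGDefined_and_eq_of_forall ⟨σ₀ + w, separates_add_const.2 hσ₀⟩ fun σ hσ ↦ ?_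
  obtain ⟨hint, heq⟩ := h (σ - w) (separates_add_const.1 (by rwa [sub_add_cancel]))
  have hshift (t : ℝ) : meijerIntegrand m n (fun j ↦ a j + w) (fun j ↦ b j + w) z
      (σ + t * Complex.I) =
        z ^ (w : ℂ) * meijerIntegrand m n a b z ((σ - w : ℝ) + t * Complex.I) := by
    rw [← meijerIntegrand_add_const hz]
    push_cast
    ring_nf
  refine ⟨by simpa only [hshift] using hint.const_mul _, ?_⟩
  rw [← heq, mellinBarnes, mellinBarnes]
  simp only [hshift, integral_const_mul]
  ring

end MeijerG

section GammaRatio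

/-- The conditional mean of `(1 + X / Y) ^ (-ν)` given `X = x`, when `Y` has law `κ` and is
independent of `X`. -/
noncomputable def condMean (κ : Measure ℝ) (ν x : ℝ) : ℝ := ∫ y, (1 + x / y) ^ (-ν) ∂κ

theorem integrable_one_add_div_rpow {S : Type*} [MeasurableSpace S] {ρ : Measure S}
    [IsFiniteMeasure ρ] {X Y : S → ℝ} {ν : ℝ} (hν : 0 ≤ ν) (hX : AEMeasurable X ρ)
    (hY : AEMeasurable Y ρ) (hX₀ : ∀ᵐ s ∂ρ, 0 ≤ X s) (hY₀ : ∀ᵐ s ∂ρ, 0 ≤ Y s) :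
    Integrable (fun s ↦ (1 + X s / Y s) ^ (-ν)) ρ := by
  refine .of_bound (AEMeasurable.aestronglyMeasurable (by fun_prop)) 1 ?_
  filter_upwards [hX₀, hY₀] with s hXs hYs
  have hone : 1 ≤ 1 + X s / Y s := le_add_of_nonneg_right (div_nonneg hXs hYs)
  rw [Real.norm_of_nonneg (Real.rpow_nonneg (zero_le_one.trans hone) _)]
  exact Real.rpow_le_one_of_one_le_of_nonpos hone (neg_nonpos.2 hν)

theorem integrable_condMean {S : Type*} [MeasurableSpace S] {ρ : Measure S} [IsFiniteMeasure ρ]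
    {κ : Measure ℝ} [IsFiniteMeasure κ] {X : S → ℝ} {ν : ℝ} (hν : 0 ≤ ν) (hX : AEMeasurable X ρ)
    (hX₀ : ∀ᵐ s ∂ρ, 0 ≤ X s) (hκ : ∀ᵐ y ∂κ, 0 ≤ y) :
    Integrable (fun s ↦ condMean κ ν (X s)) ρ :=
  (integrable_one_add_div_rpow (ρ := ρ.prod κ) hν hX.comp_fst measurable_snd.aemeasurable
    (Measure.quasiMeasurePreserving_fst.ae hX₀)
    (Measure.quasiMeasurePreserving_snd.ae hκ)).integral_prod_left

theorem integral_condMean {S : Type*} [MeasurableSpace S] {ρ : Measure S} [IsFiniteMeasure ρ]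
    {κ : Measure ℝ} [IsFiniteMeasure κ] {X : S → ℝ} {ν : ℝ} (hν : 0 ≤ ν) (hX : AEMeasurable X ρ)
    (hX₀ : ∀ᵐ s ∂ρ, 0 ≤ X s) (hκ : ∀ᵐ y ∂κ, 0 ≤ y) :
    ∫ s, condMean κ ν (X s) ∂ρ = ∫ q : S × ℝ, (1 + X q.1 / q.2) ^ (-ν) ∂ρ.prod κ :=
  (integral_prod _ (integrable_one_add_div_rpow (ρ := ρ.prod κ) hν hX.comp_fst
    measurable_snd.aemeasurable (Measure.quasiMeasurePreserving_fst.ae hX₀)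
    (Measure.quasiMeasurePreserving_snd.ae hκ))).symm

variable {α δ ν r₁ r₂ : ℝ}

theorem ae_pos_gammaMeasure_prod (α r₁ δ r₂ : ℝ) :
    ∀ᵐ q ∂(gammaMeasure α r₁).prod (gammaMeasure δ r₂), 0 < q.1 ∧ 0 < q.2 :=
  (Measure.quasiMeasurePreserving_fst.ae (ae_pos_gammaMeasure α r₁)).and
    (Measure.quasiMeasurePreserving_snd.ae (ae_pos_gammaMeasure δ r₂))

theorem integral_exp_neg_mul_gammaMeasure_one (hν : 0 < ν) {x : ℝ} (hx : 0 ≤ x) :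
    ∫ z, Real.exp (-(z * x)) ∂gammaMeasure ν 1 = (1 + x) ^ (-ν) := by
  have h := mgf_id_gammaMeasure hν one_pos (t := -x) (by linarith)
  rw [sub_neg_eq_add, one_div, Real.inv_rpow (by linarith), ← Real.rpow_neg (by linarith)] at h
  simp only [← h, mgf, id_eq, neg_mul, mul_comm x]

/-- The law of `(Z, (X, Y))` for independent `Z ∼ Γ(ν, 1)`, `X ∼ Γ(α, r₁)` and `Y ∼ Γ(δ, r₂)`. The
auxiliary variable `Z` turns `(1 + X / Y) ^ (-ν)` into the mean of `exp (-Z * X / Y)`. -/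
noncomputable def gammaTriple (ν α r₁ δ r₂ : ℝ) : Measure (ℝ × ℝ × ℝ) :=
  (gammaMeasure ν 1).prod ((gammaMeasure α r₁).prod (gammaMeasure δ r₂))

theorem isProbabilityMeasure_gammaTriple (hν : 0 < ν) (hα : 0 < α) (hr₁ : 0 < r₁) (hδ : 0 < δ)
    (hr₂ : 0 < r₂) : IsProbabilityMeasure (gammaTriple ν α r₁ δ r₂) := by
  have := isProbabilityMeasure_gammaMeasure hν one_pos
  have := isProbabilityMeasure_gammaMeasure hα hr₁
  have := isProbabilityMeasure_gammaMeasure hδ hr₂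
  unfold gammaTriple
  infer_instance

theorem ae_pos_gammaTriple (ν α r₁ δ r₂ : ℝ) :
    ∀ᵐ p ∂gammaTriple ν α r₁ δ r₂, 0 < p.1 ∧ 0 < p.2.1 ∧ 0 < p.2.2 :=
  (Measure.quasiMeasurePreserving_fst.ae (ae_pos_gammaMeasure ν 1)).and
    (Measure.quasiMeasurePreserving_snd.ae (ae_pos_gammaMeasure_prod α r₁ δ r₂))

theorem integral_condMean_gammaMeasure (hν : 0 < ν) (hα : 0 < α) (hr₁ : 0 < r₁) (hδ : 0 < δ)
    (hr₂ : 0 < r₂) :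
    ∫ x, condMean (gammaMeasure δ r₂) ν x ∂gammaMeasure α r₁ =
      ∫ p, Real.exp (-(p.1 * (p.2.1 / p.2.2))) ∂gammaTriple ν α r₁ δ r₂ := by
  have := isProbabilityMeasure_gammaMeasure hν one_pos
  have := isProbabilityMeasure_gammaMeasure hα hr₁
  have := isProbabilityMeasure_gammaMeasure hδ hr₂
  have := isProbabilityMeasure_gammaTriple hν hα hr₁ hδ hr₂
  have hint : Integrable (fun p : ℝ × ℝ × ℝ ↦ Real.exp (-(p.1 * (p.2.1 / p.2.2))))
      (gammaTriple ν α r₁ δ r₂) := by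
    refine .of_bound (Measurable.aestronglyMeasurable (by fun_prop)) 1 ?_
    filter_upwards [ae_pos_gammaTriple ν α r₁ δ r₂] with p ⟨hp, hp₁, hp₂⟩
    rw [Real.norm_of_nonneg (Real.exp_pos _).le, Real.exp_le_one_iff, neg_nonpos]
    positivity
  rw [integral_condMean (X := fun x ↦ x) hν.le aemeasurable_id
    ((ae_pos_gammaMeasure α r₁).mono fun _ ↦ le_of_lt)
    ((ae_pos_gammaMeasure δ r₂).mono fun _ ↦ le_of_lt), gammaTriple, integral_prod_symm _ hint]
  refine integral_congr_ae ?_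
  filter_upwards [ae_pos_gammaMeasure_prod α r₁ δ r₂] with q ⟨hq₁, hq₂⟩
  exact (integral_exp_neg_mul_gammaMeasure_one hν (div_pos hq₁ hq₂).le).symm

theorem integrable_rpow_gammaTriple {c : ℝ} (hα : 0 < α) (hr₁ : 0 < r₁) (hδ : 0 < δ)
    (hr₂ : 0 < r₂) (hc : 0 < c) (hcν : c < ν) (hcα : c < α) :
    Integrable (fun p : ℝ × ℝ × ℝ ↦ (p.1 * (p.2.1 / p.2.2)) ^ (-c)) (gammaTriple ν α r₁ δ r₂) := by
  have hν := hc.trans hcν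
  refine ((integrable_rpow_gammaMeasure hν one_pos (p := -c) (by linarith)).mul_prod
    ((integrable_rpow_gammaMeasure hα hr₁ (p := -c) (by linarith)).mul_prod
      (integrable_rpow_gammaMeasure hδ hr₂ (p := c) (by linarith)))).congr ?_
  filter_upwards [ae_pos_gammaTriple ν α r₁ δ r₂] with p ⟨hp, hp₁, hp₂⟩
  rw [Real.mul_rpow hp.le (div_pos hp₁ hp₂).le, Real.div_rpow hp₁.le hp₂.le,
    Real.rpow_neg hp₂.le, div_inv_eq_mul]

theorem integral_cpow_gammaTriple {u : ℂ} (hα : 0 < α) (hr₁ : 0 < r₁) (hδ : 0 < δ)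
    (hr₂ : 0 < r₂) (hu : 0 < u.re) (huν : u.re < ν) (huα : u.re < α) :
    ∫ p, ((p.1 * (p.2.1 / p.2.2) : ℝ) : ℂ) ^ (-u) ∂gammaTriple ν α r₁ δ r₂ =
      Complex.Gamma (α - u) * Complex.Gamma (ν - u) * Complex.Gamma (δ + u) *
        ((r₁ / r₂ : ℝ) : ℂ) ^ u / (Complex.Gamma α * Complex.Gamma δ * Complex.Gamma ν) := by
  have hν := hu.trans huν
  have := isProbabilityMeasure_gammaMeasure hν one_pos
  have := isProbabilityMeasure_gammaMeasure hα hr₁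
  have := isProbabilityMeasure_gammaMeasure hδ hr₂
  calc ∫ p, ((p.1 * (p.2.1 / p.2.2) : ℝ) : ℂ) ^ (-u) ∂gammaTriple ν α r₁ δ r₂
      = ∫ p, (p.1 : ℂ) ^ (-u) * ((p.2.1 : ℂ) ^ (-u) * (p.2.2 : ℂ) ^ u)
          ∂gammaTriple ν α r₁ δ r₂ := by
        refine integral_congr_ae ?_
        filter_upwards [ae_pos_gammaTriple ν α r₁ δ r₂] with p ⟨hp, hp₁, hp₂⟩
        rw [Complex.ofReal_mul, Complex.mul_cpow_ofReal_nonneg hp.le (div_pos hp₁ hp₂).le,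
          Complex.ofReal_div, Complex.div_cpow_ofReal_nonneg hp₁.le hp₂.le,
          Complex.cpow_neg (p.2.2 : ℂ), div_inv_eq_mul]
    _ = (∫ z, (z : ℂ) ^ (-u) ∂gammaMeasure ν 1) * ((∫ x, (x : ℂ) ^ (-u) ∂gammaMeasure α r₁) *
          ∫ y, (y : ℂ) ^ u ∂gammaMeasure δ r₂) := by
        rw [gammaTriple, ← integral_prod_mul, ← integral_prod_mul]
    _ = Complex.Gamma (α - u) * Complex.Gamma (ν - u) * Complex.Gamma (δ + u) *
          ((r₁ / r₂ : ℝ) : ℂ) ^ u / (Complex.Gamma α * Complex.Gamma δ * Complex.Gamma ν) := by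
        rw [integral_cpow_gammaMeasure hν one_pos (by simpa), integral_cpow_gammaMeasure hα hr₁
          (by simpa), integral_cpow_gammaMeasure hδ hr₂ (by linarith), Complex.ofReal_div,
          Complex.div_cpow_ofReal_nonneg hr₁.le hr₂.le, Complex.cpow_neg (r₂ : ℂ)]
        simp only [neg_neg, Complex.ofReal_one, Complex.one_cpow, ← sub_eq_add_neg]
        ring

theorem separates_gammaRatio {σ : ℝ} :
    Separates 2 2 ![1 - (δ : ℂ), 1] ![(α : ℂ), ν] σ ↔ (σ < α ∧ σ < ν) ∧ -δ < σ ∧ 0 < σ := by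
  simp [Separates, Fin.forall_fin_two]

theorem meijerIntegrand_gammaRatio (z u : ℂ) :
    meijerIntegrand 2 2 ![1 - (δ : ℂ), 1] ![(α : ℂ), ν] z u =
      Complex.Gamma u * (Complex.Gamma (α - u) * Complex.Gamma (ν - u) * Complex.Gamma (δ + u) *
        z ^ u) := by
  simp only [meijerIntegrand, Fin.prod_univ_two, Fin.val_zero, Fin.val_one, Nat.zero_lt_two,
    Nat.one_lt_two, if_true, Matrix.cons_val_zero, Matrix.cons_val_one, sub_sub_cancel, sub_self,
    zero_add]
  ring

theorem meijerG_gammaRatio (hν : 0 < ν) (hα : 0 < α) (hr₁ : 0 < r₁) (hδ : 0 < δ) (hr₂ : 0 < r₂) :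
    MeijerGDefined 2 2 ![1 - (δ : ℂ), 1] ![(α : ℂ), ν] ((r₁ / r₂ : ℝ) : ℂ) ∧
      meijerG 2 2 ![1 - (δ : ℂ), 1] ![(α : ℂ), ν] ((r₁ / r₂ : ℝ) : ℂ) =
        ((Real.Gamma α * Real.Gamma δ * Real.Gamma ν *
          ∫ x, condMean (gammaMeasure δ r₂) ν x ∂gammaMeasure α r₁ : ℝ) : ℂ) := by
  have := isProbabilityMeasure_gammaTriple hν hα hr₁ hδ hr₂
  have hex : ∃ σ, Separates 2 2 ![1 - (δ : ℂ), 1] ![(α : ℂ), ν] σ := by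
    obtain ⟨σ, hσ, hlt⟩ := exists_between (lt_min hα hν)
    exact ⟨σ, separates_gammaRatio.2 ⟨lt_min_iff.1 hlt, by linarith, hσ⟩⟩
  refine meijerGDefined_and_eq_of_forall hex fun σ hσ ↦ ?_
  obtain ⟨⟨hσα, hσν⟩, -, hσ⟩ := separates_gammaRatio.1 hσ
  have hX : Measurable fun p : ℝ × ℝ × ℝ ↦ p.1 * (p.2.1 / p.2.2) := by fun_prop
  have hpos : ∀ᵐ p ∂gammaTriple ν α r₁ δ r₂, 0 < p.1 * (p.2.1 / p.2.2) :=
    (ae_pos_gammaTriple ν α r₁ δ r₂).mono fun p ⟨hp, hp₁, hp₂⟩ ↦ by positivity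
  have hmoment := integrable_rpow_gammaTriple hα hr₁ hδ hr₂ hσ hσν hσα
  have hΓ {x : ℝ} (hx : 0 < x) : Complex.Gamma x ≠ 0 := Complex.Gamma_ne_zero_of_re_pos (by simpa)
  have hintegrand (t : ℝ) : meijerIntegrand 2 2 ![1 - (δ : ℂ), 1] ![(α : ℂ), ν]
      ((r₁ / r₂ : ℝ) : ℂ) (σ + t * Complex.I) =
        Complex.Gamma α * Complex.Gamma δ * Complex.Gamma ν *
          (Complex.Gamma (σ + t * Complex.I) * ∫ p, ((p.1 * (p.2.1 / p.2.2) : ℝ) : ℂ) ^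
            (-(σ + t * Complex.I)) ∂gammaTriple ν α r₁ δ r₂) := by
    rw [integral_cpow_gammaTriple hα hr₁ hδ hr₂ (by simpa) (by simpa) (by simpa),
      meijerIntegrand_gammaRatio]
    field_simp [hΓ hα, hΓ hδ, hΓ hν]
  refine ⟨?_, ?_⟩
  · simpa only [hintegrand] using (integrable_Gamma_mul_integral_cpow hσ hX.aemeasurable hpos
      hmoment).const_mul (Complex.Gamma α * Complex.Gamma δ * Complex.Gamma ν)
  · rw [Complex.ofReal_mul, integral_condMean_gammaMeasure hν hα hr₁ hδ hr₂,
      integral_exp_neg_eq_integral_Gamma_mul hσ hX.aemeasurable hpos hmoment, mellinBarnes]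
    simp only [hintegrand, integral_const_mul, Complex.ofReal_mul, ← Complex.Gamma_ofReal]
    ring

end GammaRatio

section ComplexNormal

theorem integral_inv_pi_mul_exp_neg_mul_normSq {b : ℝ} (hb : 0 < b) :
    ∫ z : ℂ, Real.pi⁻¹ * Real.exp (-b * ‖z‖ ^ 2) = b⁻¹ := by
  rw [integral_const_mul, GaussianFourier.integral_rexp_neg_mul_sq_norm hb,
    Complex.finrank_real_complex, Nat.cast_ofNat, div_self two_ne_zero, Real.rpow_one,
    div_eq_mul_inv, inv_mul_cancel_left₀ Real.pi_ne_zero]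

theorem isProbabilityMeasure_stdComplexNormal : IsProbabilityMeasure stdComplexNormal := by
  have h := integral_inv_pi_mul_exp_neg_mul_normSq one_pos
  simp only [neg_mul, one_mul, inv_one] at h
  refine ⟨?_⟩
  rw [stdComplexNormal, withDensity_apply _ .univ, Measure.restrict_univ,
    ← ofReal_integral_eq_lintegral_ofReal (.of_integral_ne_zero (by simp [h]))
      (ae_of_all _ fun z ↦ by positivity), h, ENNReal.ofReal_one]

theorem mgf_const_mul_normSq_stdComplexNormal {c t : ℝ} (hc : 0 < c) (ht : t < c⁻¹) :
    mgf (fun z ↦ c * ‖z‖ ^ 2) stdComplexNormal t = c⁻¹ / (c⁻¹ - t) := by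
  have hb : 0 < 1 - t * c := by
    rw [sub_pos, ← lt_div_iff₀ hc, one_div]
    exact ht
  rw [mgf, stdComplexNormal, integral_withDensity_eq_integral_toReal_smul (by fun_prop)
    (ae_of_all _ fun _ ↦ ENNReal.ofReal_lt_top)]
  calc ∫ z : ℂ, (ENNReal.ofReal (Real.pi⁻¹ * Real.exp (-‖z‖ ^ 2))).toReal •
        Real.exp (t * (c * ‖z‖ ^ 2))
      = ∫ z : ℂ, Real.pi⁻¹ * Real.exp (-(1 - t * c) * ‖z‖ ^ 2) := by
        refine integral_congr_ae (ae_of_all _ fun z ↦ ?_)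
        simp only [ENNReal.toReal_ofReal
          (show 0 ≤ Real.pi⁻¹ * Real.exp (-‖z‖ ^ 2) by positivity), smul_eq_mul, mul_assoc,
          ← Real.exp_add]
        ring_nf
    _ = c⁻¹ / (c⁻¹ - t) := by
        rw [integral_inv_pi_mul_exp_neg_mul_normSq hb]
        have : c⁻¹ - t = c⁻¹ * (1 - t * c) := by field_simp
        rw [this]
        field_simp

theorem hasLaw_const_mul_normSq_stdComplexNormal {c : ℝ} (hc : 0 < c) :
    HasLaw (fun z ↦ c * ‖z‖ ^ 2) (gammaMeasure 1 c⁻¹) stdComplexNormal := by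
  have := isProbabilityMeasure_stdComplexNormal
  refine hasLaw_gammaMeasure_of_mgf (by fun_prop) one_pos (inv_pos.2 hc) fun t ht ↦ ?_
  rw [mgf_const_mul_normSq_stdComplexNormal hc ht, Real.rpow_one]

end ComplexNormal

namespace Params

variable (P : Params)

theorem pairBandwidth_pos : 0 < P.pairBandwidth :=
  div_pos (mul_pos two_pos P.B_pos) (Nat.cast_pos.2 P.K_pos)

theorem ν_pos : 0 < P.ν :=
  div_pos (mul_pos (mul_pos P.θ_pos P.T_pos) P.pairBandwidth_pos) (Real.log_pos one_lt_two)

theorem Ihat_pos : 0 < P.Ihat := div_pos P.I_pos (mul_pos P.N0_pos P.pairBandwidth_pos)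

theorem Ωpair_pos : 0 < P.Ωpair :=
  div_pos (mul_pos (P.Ω_pos _) (P.Ω_pos _)) (add_pos (P.Ω_pos _) (P.Ω_pos _))

theorem inv_Ω_near_add_inv_Ω_far : (P.Ω .near)⁻¹ + (P.Ω .far)⁻¹ = P.Ωpair⁻¹ := by
  rw [inv_add_inv (P.Ω_pos _).ne' (P.Ω_pos _).ne', Ωpair, inv_div]

/-- The mean `Ω_p / (a_s Î)` of the normalized interference gain `g_p / (a_s Î)`, by which the gain
of the strong user is divided in its SNR. -/
noncomputable def interferenceMean : ℝ := P.Ωp / (P.as * P.Ihat)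

theorem interferenceMean_pos : 0 < P.interferenceMean :=
  div_pos P.Ωp_pos (mul_pos P.as_pos P.Ihat_pos)

section Gains

variable {S : Type*} {hp : S → ℂ} {h : (u : User) → Fin (P.N u) → S → ℂ}

theorem gain_nonneg (u : User) (s : S) : 0 ≤ P.gain h u s :=
  Finset.sum_nonneg fun _ _ ↦ sq_nonneg _

theorem gain_strongUser (s : S) :
    P.gain h (P.strongUser h s) s = max (P.gain h .near s) (P.gain h .far s) := by
  unfold strongUser
  split_ifs with hle
  · rw [max_eq_left hle]
  · rw [max_eq_right (not_le.1 hle).le]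

theorem snrStrong_eq (s : S) : P.snrStrong hp h s =
    max (P.gain h .near s) (P.gain h .far s) / (P.gainPrimary hp s / (P.as * P.Ihat)) := by
  rw [snrStrong, gain_strongUser, transmitPower, Ihat, div_div_eq_mul_div]
  ring

theorem snrStrong_nonneg (s : S) : 0 ≤ P.snrStrong hp h s := by
  rw [snrStrong_eq]
  exact div_nonneg (le_max_of_le_left (P.gain_nonneg _ s))
    (div_nonneg (sq_nonneg _) (mul_pos P.as_pos P.Ihat_pos).le)

variable [MeasurableSpace S] {μ : Measure S}

theorem hasLaw_gainPrimary_div (hp_law : HasLaw hp stdComplexNormal μ) :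
    HasLaw (fun s ↦ P.gainPrimary hp s / (P.as * P.Ihat))
      (gammaMeasure 1 P.interferenceMean⁻¹) μ := by
  refine ((hasLaw_const_mul_normSq_stdComplexNormal P.interferenceMean_pos).comp
    hp_law).congr (ae_of_all _ fun s ↦ ?_)
  simp only [gainPrimary, norm_mul, mul_pow, Complex.norm_real, Real.norm_eq_abs, sq_abs,
    Real.sq_sqrt P.Ωp_pos.le, Function.comp_apply, interferenceMean]
  ring

theorem hasLaw_gain (u : User) (h_law : ∀ i, HasLaw (h u i) stdComplexNormal μ)
    (h_indep : iIndepFun (h u) μ) :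
    HasLaw (P.gain h u) (gammaMeasure (P.N u) (P.Ω u)⁻¹) μ := by
  have hind := h_indep.comp (fun _ z ↦ P.Ω u * ‖z‖ ^ 2) fun _ ↦ by fun_prop
  have hsum := hasLaw_sum_gammaMeasure (s := Finset.univ)
    (Finset.univ_nonempty_iff.2 (Fin.pos_iff_nonempty.1 (P.N_pos u))) (fun _ _ ↦ one_pos)
    (inv_pos.2 (P.Ω_pos u)) (fun i ↦
      (hasLaw_const_mul_normSq_stdComplexNormal (P.Ω_pos u)).comp (h_law i)) hind
  rw [Fin.sum_const, nsmul_one] at hsum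
  refine hsum.congr (ae_of_all _ fun s ↦ ?_)
  simp only [gain, norm_mul, mul_pow, Complex.norm_real, Real.norm_eq_abs, sq_abs,
    Real.sq_sqrt (P.Ω_pos u).le, Finset.sum_apply, Function.comp_apply]

variable (hp_law : HasLaw hp stdComplexNormal μ) (h_law : ∀ u i, HasLaw (h u i) stdComplexNormal μ)
  (h_indep : iIndepFun (fun k : Option (Σ u : User, Fin (P.N u)) ↦
    k.elim hp fun i ↦ h i.1 i.2) μ)

include hp_law h_law in
theorem aemeasurable_link (k : Option (Σ u : User, Fin (P.N u))) :
    AEMeasurable (k.elim hp fun i ↦ h i.1 i.2) μ := by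
  rcases k with _ | ⟨u, i⟩
  exacts [hp_law.aemeasurable, (h_law u i).aemeasurable]

include hp_law h_law h_indep

theorem indepFun_gain_near_far : IndepFun (P.gain h .near) (P.gain h .far) μ := by
  have hind := indepFun_pi_of_disjoint_range h_indep (P.aemeasurable_link hp_law h_law)
    (e₁ := fun i : Fin (P.N .near) ↦ some ⟨.near, i⟩)
    (e₂ := fun i : Fin (P.N .far) ↦ some ⟨.far, i⟩) (by simp [Set.disjoint_left])
  simp only [Option.elim_some] at hind
  have hm (u : User) : Measurable fun v : Fin (P.N u) → ℂ ↦
      ∑ i, ‖(Real.sqrt (P.Ω u) : ℂ) * v i‖ ^ 2 := by fun_prop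
  exact hind.comp (hm .near) (hm .far)

theorem indepFun_gains_gainPrimary :
    IndepFun (fun s ↦ (P.gain h .near s, P.gain h .far s)) (P.gainPrimary hp) μ := by
  have hind := indepFun_pi_of_disjoint_range h_indep (P.aemeasurable_link hp_law h_law)
    (e₁ := Sum.elim (fun i : Fin (P.N .near) ↦ some ⟨.near, i⟩)
      (fun i : Fin (P.N .far) ↦ some ⟨.far, i⟩))
    (e₂ := fun _ : Unit ↦ none)
    (Set.disjoint_left.2 (by rintro _ ⟨_ | _, rfl⟩ ⟨_, h⟩ <;> simp at h))
  have hm : Measurable fun v : Fin (P.N .near) ⊕ Fin (P.N .far) → ℂ ↦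
      (∑ i, ‖(Real.sqrt (P.Ω .near) : ℂ) * v (.inl i)‖ ^ 2,
        ∑ i, ‖(Real.sqrt (P.Ω .far) : ℂ) * v (.inr i)‖ ^ 2) := by fun_prop
  have hmp : Measurable fun v : Unit → ℂ ↦ ‖(Real.sqrt P.Ωp : ℂ) * v ()‖ ^ 2 := by fun_prop
  exact hind.comp hm hmp

theorem hasLaw_gains :
    HasLaw (fun s ↦ ((P.gain h .near s, P.gain h .far s), P.gainPrimary hp s / (P.as * P.Ihat)))
      (((gammaMeasure (P.N .near) (P.Ω .near)⁻¹).prod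
        (gammaMeasure (P.N .far) (P.Ω .far)⁻¹)).prod (gammaMeasure 1 P.interferenceMean⁻¹)) μ := by
  have := h_indep.isProbabilityMeasure
  have hgain (u : User) : HasLaw (P.gain h u) (gammaMeasure (P.N u) (P.Ω u)⁻¹) μ :=
    P.hasLaw_gain u (h_law u) (h_indep.precomp (g := fun i ↦ some ⟨u, i⟩) fun i j hij ↦ by
      simpa using hij)
  have hprim := P.hasLaw_gainPrimary_div hp_law
  have (u : User) : IsProbabilityMeasure (gammaMeasure (P.N u) (P.Ω u)⁻¹) :=
    isProbabilityMeasure_gammaMeasure (Nat.cast_pos.2 (P.N_pos u)) (inv_pos.2 (P.Ω_pos u))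
  have : IsProbabilityMeasure (gammaMeasure 1 P.interferenceMean⁻¹) :=
    isProbabilityMeasure_gammaMeasure one_pos (inv_pos.2 P.interferenceMean_pos)
  exact ((P.indepFun_gains_gainPrimary hp_law h_law h_indep).comp measurable_id
    (measurable_id.div_const (P.as * P.Ihat))).hasLaw_prod
    ((P.indepFun_gain_near_far hp_law h_law h_indep).hasLaw_prod (hgain _) (hgain _)) hprim

end Gains

section ClosedForm

theorem upperPar_eq_add_const (k : ℕ) :
    upperPar k = fun j ↦ ![1 - ((1 : ℝ) : ℂ), 1] j + ((-k : ℝ) : ℂ) := by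
  ext j
  fin_cases j <;> simp [upperPar, sub_eq_add_neg]

theorem lowerPar_eq_add_const (k : ℕ) :
    P.lowerPar k = fun j ↦ ![((k : ℝ) : ℂ), P.ν] j + ((-k : ℝ) : ℂ) := by
  ext j
  fin_cases j <;> simp [lowerPar, sub_eq_add_neg]

theorem meijerG_par {k : ℕ} {r₁ r₂ : ℝ} (hk : k ≠ 0) (hr₁ : 0 < r₁) (hr₂ : 0 < r₂) :
    MeijerGDefined 2 2 (upperPar k) (P.lowerPar k) ((r₁ / r₂ : ℝ) : ℂ) ∧
      meijerG 2 2 (upperPar k) (P.lowerPar k) ((r₁ / r₂ : ℝ) : ℂ) =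
        ((((r₁ / r₂) ^ k)⁻¹ * (Real.Gamma k * Real.Gamma P.ν *
          ∫ x, condMean (gammaMeasure 1 r₂) P.ν x ∂gammaMeasure k r₁) : ℝ) : ℂ) := by
  have hz := div_pos hr₁ hr₂
  obtain ⟨hdef, hval⟩ :=
    meijerG_gammaRatio P.ν_pos (Nat.cast_pos.2 hk.bot_lt) hr₁ one_pos hr₂
  obtain ⟨hdef', hval'⟩ := hdef.add_const (Complex.ofReal_ne_zero.2 hz.ne') (-k)
  rw [upperPar_eq_add_const, lowerPar_eq_add_const]
  refine ⟨hdef', ?_⟩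
  rw [hval', hval, ← Complex.ofReal_cpow hz.le, Real.rpow_neg hz.le, Real.rpow_natCast,
    Real.Gamma_one, mul_one, ← Complex.ofReal_mul]

theorem meijerGDefined_par {k : ℕ} {z : ℝ} (hk : k ≠ 0) (hz : 0 < z) :
    MeijerGDefined 2 2 (upperPar k) (P.lowerPar k) (z : ℂ) := by
  simpa only [div_one] using (P.meijerG_par hk hz one_pos).1

/-- The conditional mean of `(1 + γ_s) ^ (-ν)` given that the gain of the strong user is `x`. -/
noncomputable def condMeanStrong (x : ℝ) : ℝ :=
  condMean (gammaMeasure 1 P.interferenceMean⁻¹) P.ν x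

theorem T₁_eq_integral {k : ℕ} {β : ℝ} (hk : k ≠ 0) (hβ : 0 < β) :
    P.T₁ k β = ((∫ x, P.condMeanStrong x ∂gammaMeasure k β⁻¹ : ℝ) : ℂ) := by
  have hz : P.Ωp / (β * P.as * P.Ihat) = β⁻¹ / P.interferenceMean⁻¹ := by
    rw [interferenceMean]
    field_simp
  have hpow := pow_pos (div_pos (inv_pos.2 hβ) (inv_pos.2 P.interferenceMean_pos)) k
  have hν := Real.Gamma_pos_of_pos P.ν_pos
  rw [T₁, hz, (P.meijerG_par hk (inv_pos.2 hβ) (inv_pos.2 P.interferenceMean_pos)).2,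
    ← Complex.ofReal_mul]
  simp only [condMeanStrong]
  generalize (β⁻¹ / P.interferenceMean⁻¹) ^ k = w at hpow ⊢
  field_simp

theorem T₂_eq_sum_integral {α₁ α₂ : ℕ} {β₁ β₂ : ℝ} (hα₁ : α₁ ≠ 0) :
    P.T₂ α₁ α₂ β₁ β₂ = ((∑ τ ∈ Finset.range α₂,
      P.Ωpair ^ (α₁ + τ) * Real.Gamma (α₁ + τ) /
        (Real.Gamma α₁ * β₁ ^ α₁ * β₂ ^ τ * τ.factorial) *
        ∫ x, P.condMeanStrong x ∂gammaMeasure (α₁ + τ) P.Ωpair⁻¹ : ℝ) : ℂ) := by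
  have hz : P.Ωp / (P.Ωpair * P.as * P.Ihat) = P.Ωpair⁻¹ / P.interferenceMean⁻¹ := by
    rw [interferenceMean]
    field_simp
  have hΩ := P.Ωpair_pos
  have hm := P.interferenceMean_pos
  have hν := Real.Gamma_pos_of_pos P.ν_pos
  rw [T₂, Complex.ofReal_sum]
  refine Finset.sum_congr rfl fun τ _ ↦ ?_
  rw [hz, (P.meijerG_par (by omega) (inv_pos.2 hΩ) (inv_pos.2 hm)).2, ← Complex.ofReal_mul,
    ← interferenceMean, Nat.cast_add]
  simp only [condMeanStrong, div_pow, inv_pow]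
  field_simp

theorem integrable_condMeanStrong {a r : ℝ} (ha : 0 < a) (hr : 0 < r) :
    Integrable P.condMeanStrong (gammaMeasure a r) := by
  have := isProbabilityMeasure_gammaMeasure ha hr
  have := isProbabilityMeasure_gammaMeasure one_pos (inv_pos.2 P.interferenceMean_pos)
  exact integrable_condMean P.ν_pos.le aemeasurable_id
    ((ae_pos_gammaMeasure a r).mono fun _ ↦ le_of_lt)
    ((ae_pos_gammaMeasure 1 P.interferenceMean⁻¹).mono fun _ ↦ le_of_lt)

theorem integral_real_Iic_smul_condMeanStrong {α₁ α₂ : ℕ} {β₁ β₂ : ℝ} (hα₁ : α₁ ≠ 0)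
    (hα₂ : α₂ ≠ 0) (hβ₁ : 0 < β₁) (hβ₂ : 0 < β₂) (hβ : β₁⁻¹ + β₂⁻¹ = P.Ωpair⁻¹) :
    ((∫ x, (gammaMeasure α₂ β₂⁻¹).real (Set.Iic x) • P.condMeanStrong x
      ∂gammaMeasure α₁ β₁⁻¹ : ℝ) : ℂ) = P.T₁ α₁ β₁ - P.T₂ α₁ α₂ β₁ β₂ := by
  have hα₁' : (0 : ℝ) < α₁ := Nat.cast_pos.2 hα₁.bot_lt
  rw [integral_real_Iic_smul_gammaMeasure hα₁' (inv_pos.2 hβ₁) hα₂ (inv_pos.2 hβ₂)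
    (P.integrable_condMeanStrong hα₁' (inv_pos.2 hβ₁)), P.T₁_eq_integral hα₁ hβ₁,
    P.T₂_eq_sum_integral hα₁, ← Complex.ofReal_sub, hβ]
  congr 2
  refine Finset.sum_congr rfl fun τ _ ↦ ?_
  rw [← Nat.cast_add, Real.rpow_natCast, Real.rpow_natCast, smul_eq_mul]
  simp only [inv_pow]
  field_simp

end ClosedForm

section Expectation

variable {S : Type*} [MeasurableSpace S] {μ : Measure S} {hp : S → ℂ}
  {h : (u : User) → Fin (P.N u) → S → ℂ} (hp_law : HasLaw hp stdComplexNormal μ)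
  (h_law : ∀ u i, HasLaw (h u i) stdComplexNormal μ)
  (h_indep : iIndepFun (fun k : Option (Σ u : User, Fin (P.N u)) ↦
    k.elim hp fun i ↦ h i.1 i.2) μ)

include hp_law h_law h_indep

theorem integrable_one_add_snrStrong_rpow :
    Integrable (fun s ↦ (1 + P.snrStrong hp h s) ^ (-P.ν)) μ := by
  have := h_indep.isProbabilityMeasure
  have hlaw := P.hasLaw_gains hp_law h_law h_indep
  simp only [snrStrong_eq]
  exact integrable_one_add_div_rpow P.ν_pos.le
    ((measurable_fst.fst.max measurable_fst.snd).comp_aemeasurable hlaw.aemeasurable)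
    (measurable_snd.comp_aemeasurable hlaw.aemeasurable)
    (ae_of_all _ fun s ↦ le_max_of_le_left (P.gain_nonneg _ s))
    (ae_of_all _ fun s ↦ div_nonneg (sq_nonneg _) (mul_pos P.as_pos P.Ihat_pos).le)

theorem integral_one_add_snrStrong_rpow_pos :
    0 < ∫ s, (1 + P.snrStrong hp h s) ^ (-P.ν) ∂μ := by
  have := h_indep.isProbabilityMeasure
  have hpos (s : S) : 0 < (1 + P.snrStrong hp h s) ^ (-P.ν) :=
    Real.rpow_pos_of_pos (add_pos_of_pos_of_nonneg one_pos (P.snrStrong_nonneg s)) _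
  rw [integral_pos_iff_support_of_nonneg (fun s ↦ (hpos s).le)
    (P.integrable_one_add_snrStrong_rpow hp_law h_law h_indep),
    Function.support_eq_univ fun s ↦ (hpos s).ne', measure_univ]
  exact one_pos

theorem integral_one_add_snrStrong_rpow_eq_integral_max :
    ∫ s, (1 + P.snrStrong hp h s) ^ (-P.ν) ∂μ =
      ∫ p : ℝ × ℝ, P.condMeanStrong (max p.1 p.2) ∂(gammaMeasure (P.N .near) (P.Ω .near)⁻¹).prod
        (gammaMeasure (P.N .far) (P.Ω .far)⁻¹) := by
  have hN (u : User) : (0 : ℝ) < P.N u := Nat.cast_pos.2 (P.N_pos u)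
  have hΩ (u : User) := inv_pos.2 (P.Ω_pos u)
  have (u : User) := isProbabilityMeasure_gammaMeasure (hN u) (hΩ u)
  have := isProbabilityMeasure_gammaMeasure one_pos (inv_pos.2 P.interferenceMean_pos)
  simp only [snrStrong_eq, condMeanStrong]
  rw [integral_condMean (X := fun p : ℝ × ℝ ↦ max p.1 p.2) P.ν_pos.le (by fun_prop)
      ((ae_pos_gammaMeasure_prod _ _ _ _).mono
        fun _ hp ↦ (lt_max_of_lt_left hp.1).le)
      ((ae_pos_gammaMeasure 1 P.interferenceMean⁻¹).mono fun _ ↦ le_of_lt),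
    ← (P.hasLaw_gains hp_law h_law h_indep).integral_comp
      (Measurable.aestronglyMeasurable (by fun_prop))]
  rfl

theorem integral_one_add_snrStrong_rpow :
    ((∫ s, (1 + P.snrStrong hp h s) ^ (-P.ν) ∂μ : ℝ) : ℂ) =
      P.T₁ (P.N .near) (P.Ω .near) + P.T₁ (P.N .far) (P.Ω .far)
        - P.T₂ (P.N .near) (P.N .far) (P.Ω .near) (P.Ω .far)
        - P.T₂ (P.N .far) (P.N .near) (P.Ω .far) (P.Ω .near) := by
  have hN (u : User) : P.N u ≠ 0 := Nat.one_le_iff_ne_zero.1 (P.N_pos u)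
  have hN' (u : User) : (0 : ℝ) < P.N u := Nat.cast_pos.2 (P.N_pos u)
  have hΩ (u : User) := inv_pos.2 (P.Ω_pos u)
  have (u : User) := isProbabilityMeasure_gammaMeasure (hN' u) (hΩ u)
  have := nullSingletonClass_gammaMeasure (P.N .near) (P.Ω .near)⁻¹
  have hpair := P.inv_Ω_near_add_inv_Ω_far
  rw [P.integral_one_add_snrStrong_rpow_eq_integral_max hp_law h_law h_indep,
    integral_comp_max_prod (P.integrable_condMeanStrong (hN' _) (hΩ _))
      (P.integrable_condMeanStrong (hN' _) (hΩ _)), Complex.ofReal_add,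
    P.integral_real_Iic_smul_condMeanStrong (hN _) (hN _) (P.Ω_pos _) (P.Ω_pos _) hpair,
    P.integral_real_Iic_smul_condMeanStrong (hN _) (hN _) (P.Ω_pos _) (P.Ω_pos _)
      ((add_comm _ _).trans hpair)]
  ring

end Expectation

end Params

end NOMA

theorem theorem1 (P : NOMA.Params) {S : Type*} [MeasurableSpace S]
    (μ : Measure S) [IsProbabilityMeasure μ]
    -- normalized fading coefficients of the interference link and of the antennas of both users
    (hp : S → ℂ) (h : (u : NOMA.User) → Fin (P.N u) → S → ℂ)
    (hp_law : HasLaw hp NOMA.stdComplexNormal μ)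
    (h_law : ∀ u i, HasLaw (h u i) NOMA.stdComplexNormal μ)
    -- all links fade independently
    (h_indep : iIndepFun
      (fun k : Option (Σ u : NOMA.User, Fin (P.N u)) => k.elim hp (fun i => h i.1 i.2)) μ) :
    -- the expectation exists
    Integrable (fun s => (1 + P.snrStrong hp h s) ^ (-P.ν)) μ ∧
    -- all Meijer G-functions of the closed form are properly defined
    (∀ k : ℕ, 1 ≤ k → ∀ z : ℝ, 0 < z →
      NOMA.MeijerGDefined 2 2 (NOMA.Params.upperPar k) (P.lowerPar k) (z : ℂ)) ∧
    -- the closed form: a positive real number under the logarithm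
    ∃ b : ℝ, 0 < b ∧
      (b : ℂ) = P.T₁ (P.N .near) (P.Ω .near) + P.T₁ (P.N .far) (P.Ω .far)
        - P.T₂ (P.N .near) (P.N .far) (P.Ω .near) (P.Ω .far)
        - P.T₂ (P.N .far) (P.N .near) (P.Ω .far) (P.Ω .near) ∧
      P.effectiveRate μ (P.snrStrong hp h) = -(1 / P.ν) * Real.logb 2 b :=
  ⟨P.integrable_one_add_snrStrong_rpow hp_law h_law h_indep,
    fun _ hk _ hz ↦ P.meijerGDefined_par (Nat.one_le_iff_ne_zero.1 hk) hz,
    ∫ s, (1 + P.snrStrong hp h s) ^ (-P.ν) ∂μ,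
    P.integral_one_add_snrStrong_rpow_pos hp_law h_law h_indep,
    P.integral_one_add_snrStrong_rpow hp_law h_law h_indep, rfl⟩
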